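/- Let $n\in\mathbb N$, $T>0$ and $\Omega=(0,T)\times\mathbb R^n$. Let $H=H(t,p)$ be a real function of class $C^1$ on $[0,T]\times\mathbb R^n$ and let $\sigma:\mathbb R^n\to\mathbb R$ be convex and of class $C^1$, with Fenchel conjugate $\sigma^*(p)=\sup_{x\in\mathbb R^n}\{\langle x,p\rangle-\sigma(x)\}\in(-\infty,+\infty]$. Put $$\varphi(t,x,q)=\langle x,q\rangle-\sigma^*(q)-\int_0^tH(\tau,q)\,d\tau .$$ Assume: (A1) For every $(t_0,x_0)\in[0,T)\times\mathbb R^n$ there are $r,N>0$ such that $\varphi(t,x,p)<\max_{|q|\le N}\varphi(t,x,q)$ whenever $(t,x)\in[0,T)\times\mathbb R^n$, $|t-t_0|+|x-x_0|<r$ and $|p|>N$. (A2) At least one of the following holds: a) $H(t,\cdot)$ is convex for all $t\in(0,T)$, or $H(t,\cdot)$ is concave for all $t\in(0,T)$; b) there are functions $g,h,k$ with $H(t,p)=g(t)h(p)+k(t)$ for all $t\in(0,T)$, $p\in\mathbb R^n$, and either $g\ge0$ on $(0,T)$ or $g\le0$ on $(0,T)$. Let $u(t,x)=\max_{q\in\mathbb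 R^n}\varphi(t,x,q)$ for $(t,x)\in[0,T)\times\mathbb R^n$ (by (A1) the maximum is attained and finite). Call a point of $\Omega$ singular if $u$ is not differentiable, as a function of $(t,x)$, at that point. If $(t_0,x_0)\in\Omega$ is singular, then for every $\varepsilon>0$ there exists $\delta>0$ such that for every $t_*\in(t_0,t_0+\delta]$ there exists $x_*$ with $|x_*-x_0|\le\varepsilon$ such that $(t_*,x_*)$ is a singular point of $\Omega$ (in particular $t_0+\delta<T$). -/

import Mathlib

namespace HopfFormula

noncomputable section

/-- The Fenchel conjugate `σ*(p) = sup_x (⟨x, p⟩ - σ x)`, with values in the extended reals. -/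
def fenchelConj {n : ℕ} (σ : EuclideanSpace ℝ (Fin n) → ℝ) (p : EuclideanSpace ℝ (Fin n)) :
    EReal :=
  ⨆ x : EuclideanSpace ℝ (Fin n), ((inner ℝ x p - σ x : ℝ) : EReal)

/-- `φ(t, x, q) = ⟨x, q⟩ - σ*(q) - ∫₀ᵗ H(τ, q) dτ`; it equals `-∞` where `σ*(q) = +∞`. -/
def phi {n : ℕ} (H : ℝ → EuclideanSpace ℝ (Fin n) → ℝ) (σ : EuclideanSpace ℝ (Fin n) → ℝ)
    (t : ℝ) (x q : EuclideanSpace ℝ (Fin n)) : EReal :=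
  ((inner ℝ x q - ∫ τ in (0 : ℝ)..t, H τ q : ℝ) : EReal) - fenchelConj σ q

/-- The Hopf-type formula `u(t, x) = max_q φ(t, x, q)`. For continuous `H` and convex `σ`, the
compatibility condition below makes the supremum finite and attained for `0 ≤ t < T`, so that
`EReal.toReal` loses nothing there. -/
def hopf {n : ℕ} (H : ℝ → EuclideanSpace ℝ (Fin n) → ℝ) (σ : EuclideanSpace ℝ (Fin n) → ℝ)
    (t : ℝ) (x : EuclideanSpace ℝ (Fin n)) : ℝ :=
  (⨆ q : EuclideanSpace ℝ (Fin n), phi H σ t x q).toReal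

/-- The compatibility condition between `H` and `σ`: locally uniformly in `(t, x)`, the values
of `φ(t, x, ·)` outside some ball are strictly below its maximum over that ball. (The function
`φ(t, x, ·)` is upper semicontinuous, so the supremum over the closed ball is a maximum.) -/
def Compatible {n : ℕ} (T : ℝ) (H : ℝ → EuclideanSpace ℝ (Fin n) → ℝ)
    (σ : EuclideanSpace ℝ (Fin n) → ℝ) : Prop :=
  ∀ t₀ ∈ Set.Ico 0 T, ∀ x₀ : EuclideanSpace ℝ (Fin n),
    ∃ r > 0, ∃ N > 0, ∀ t ∈ Set.Ico 0 T, ∀ x p : EuclideanSpace ℝ (Fin n),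
      |t - t₀| + ‖x - x₀‖ < r → N < ‖p‖ →
        phi H σ t x p <
          ⨆ q ∈ Metric.closedBall (0 : EuclideanSpace ℝ (Fin n)) N, phi H σ t x q

/-- The structural condition on `H`: it is convex in `p` for all `t`, or concave in `p` for
all `t`, or of the form `g(t) h(p) + k(t)` with `g` of constant (weak) sign. -/
def Structural {n : ℕ} (T : ℝ) (H : ℝ → EuclideanSpace ℝ (Fin n) → ℝ) : Prop :=
  ((∀ t ∈ Set.Ioo 0 T, ConvexOn ℝ Set.univ (H t)) ∨
    (∀ t ∈ Set.Ioo 0 T, ConcaveOn ℝ Set.univ (H t))) ∨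
  ∃ (g : ℝ → ℝ) (h : EuclideanSpace ℝ (Fin n) → ℝ) (k : ℝ → ℝ),
    (∀ t ∈ Set.Ioo 0 T, ∀ p, H t p = g t * h p + k t) ∧
    ((∀ t ∈ Set.Ioo 0 T, 0 ≤ g t) ∨ (∀ t ∈ Set.Ioo 0 T, g t ≤ 0))

/-- `(t, x)` is a singular point of `u` in `Ω = (0, T) × ℝⁿ`: it lies in `Ω` and `u` is not
(jointly, Fréchet) differentiable there. -/
def IsSingular {n : ℕ} (T : ℝ) (u : ℝ → EuclideanSpace ℝ (Fin n) → ℝ)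
    (t : ℝ) (x : EuclideanSpace ℝ (Fin n)) : Prop :=
  t ∈ Set.Ioo 0 T ∧
    ¬ DifferentiableAt ℝ (fun z : ℝ × EuclideanSpace ℝ (Fin n) => u z.1 z.2) (t, x)

end

end HopfFormula

/-! Write `J t = ∫₀ᵗ H(τ, ·) dτ` and `u` for the Hopf formula. By an envelope argument, `u` is
differentiable at every point where `φ(t, x, ·)` has a unique maximizer, and any maximizer is a
subgradient of `u(t, ·)` at `x`, so that it is unique wherever `u(t, ·)` is differentiable. Suppose
that at some time `t` slightly later than `t₀` every point of a small ball around `x₀` is regular.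
The maximizers near `(t₀, x₀)` stay in a fixed ball of momenta. A momentum `p` in that ball which
maximizes `⟨x₀, ·⟩ + (J t - J t₀) - u(t, ·)*` is the maximizer at the point `x₀ + ∇(J t - J t₀)(p)`,
to which the characteristic with momentum `p` carries `x₀`, and this point is regular because `∇(J t
- J t₀)` is small. The structural condition on `H` carries uniqueness of the maximizer back along
this characteristic to `(t₀, x₀)`, which is therefore regular. -/

open Asymptotics Filter MeasureTheory Metric Set Topology
open scoped Gradient

namespace HopfFormula

section Subgradient

variable {E : Type*} [NormedAddCommGroup E] [InnerProductSpace ℝ E]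

/-- `m` is a subgradient of `f` at `x` relative to the set `D`; `f` need not be convex. -/
def IsSubgradientOn (f : E → ℝ) (D : Set E) (x m : E) : Prop :=
  ∀ y ∈ D, f x + inner ℝ m (y - x) ≤ f y

variable [CompleteSpace E]

theorem isSubgradientOn_of_isMaxOn_sub {D : Set E} {s f : E → ℝ} {p g : E} (hs : ConvexOn ℝ D s)
    (hp : p ∈ D) (hf : HasGradientAt f g p) (hmax : IsMaxOn (fun q => f q - s q) D p) :
    IsSubgradientOn s D p g := by
  intro q hq
  have hslope : ∀ r ∈ Ioo (0 : ℝ) 1, r⁻¹ • (f (p + r • (q - p)) - f p) ≤ s q - s p := by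
    rintro r ⟨hr0, hr1⟩
    have hseg : (1 - r) • p + r • q = p + r • (q - p) := by module
    have hmem : p + r • (q - p) ∈ D := hs.1.add_smul_sub_mem hp hq ⟨hr0.le, hr1.le⟩
    have hconv : s (p + r • (q - p)) ≤ (1 - r) * s p + r * s q :=
      hseg ▸ hs.2 hp hq (sub_nonneg.2 hr1.le) hr0.le (sub_add_cancel 1 r)
    have hle : f (p + r • (q - p)) - s (p + r • (q - p)) ≤ f p - s p := hmax hmem
    rw [smul_eq_mul, inv_mul_le_iff₀ hr0]
    linarith
  have hlim := (hf.hasFDerivAt.hasLineDerivAt (q - p)).tendsto_slope_zero_right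
  have hle := le_of_tendsto hlim (mem_of_superset (Ioo_mem_nhdsGT one_pos) hslope)
  rw [InnerProductSpace.toDual_apply_apply] at hle
  linarith

theorem isSubgradientOn_of_hasGradientAt {D : Set E} {f : E → ℝ} {p g : E} (hf : ConvexOn ℝ D f)
    (hp : p ∈ D) (hg : HasGradientAt f g p) : IsSubgradientOn f D p g :=
  isSubgradientOn_of_isMaxOn_sub hf hp hg fun q _ => by simp

theorem IsSubgradientOn.eq_of_hasGradientAt {D : Set E} {f : E → ℝ} {x m g : E}
    (hm : IsSubgradientOn f D x m) (hD : D ∈ 𝓝 x) (hg : HasGradientAt f g x) : m = g := by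
  have hd : HasFDerivAt (fun y => f y - inner ℝ m (y - x))
      (InnerProductSpace.toDual ℝ E g - InnerProductSpace.toDual ℝ E m) x := by
    simp only [inner_sub_right]
    exact hg.hasFDerivAt.sub ((InnerProductSpace.toDual ℝ E m).hasFDerivAt.sub_const _)
  have hmin : IsLocalMin (fun y => f y - inner ℝ m (y - x)) x := by
    filter_upwards [hD] with y hy
    simpa [le_sub_iff_add_le] using hm y hy
  exact (InnerProductSpace.toDual ℝ E).injective (sub_eq_zero.1 (hmin.hasFDerivAt_eq_zero hd)).symm

end Subgradient

section Conjugate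

variable {E : Type*} [NormedAddCommGroup E] [InnerProductSpace ℝ E]

/-- The effective domain of the Fenchel conjugate of `f`. -/
def conjDom (f : E → ℝ) : Set E := {p | BddAbove (range fun x => inner ℝ x p - f x)}

/-- The Fenchel conjugate of `f` as a real function; its values off `conjDom f`, where the
conjugate is `+∞`, are junk. -/
noncomputable def conjReal (f : E → ℝ) (p : E) : ℝ := ⨆ x, (inner ℝ x p - f x)

theorem inner_sub_le_conjReal {f : E → ℝ} {p : E} (hp : p ∈ conjDom f) (x : E) :
    inner ℝ x p - f x ≤ conjReal f p := le_ciSup hp x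

theorem convexOn_conjReal (f : E → ℝ) : ConvexOn ℝ (conjDom f) (conjReal f) := by
  have hcomb : ∀ p ∈ conjDom f, ∀ q ∈ conjDom f, ∀ a b : ℝ, 0 ≤ a → 0 ≤ b → a + b = 1 → ∀ x,
      inner ℝ x (a • p + b • q) - f x ≤ a • conjReal f p + b • conjReal f q := by
    intro p hp q hq a b ha hb hab x
    calc inner ℝ x (a • p + b • q) - f x
        = a * (inner ℝ x p - f x) + b * (inner ℝ x q - f x) := by
          rw [inner_add_right, real_inner_smul_right, real_inner_smul_right]
          linear_combination f x * hab
      _ ≤ a * conjReal f p + b * conjReal f q := by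
          gcongr
          exacts [inner_sub_le_conjReal hp x, inner_sub_le_conjReal hq x]
  exact ⟨fun p hp q hq a b ha hb hab => ⟨_, forall_mem_range.2 (hcomb p hp q hq a b ha hb hab)⟩,
    fun p hp q hq a b ha hb hab => ciSup_le (hcomb p hp q hq a b ha hb hab)⟩

/-- The equality case of the Fenchel–Young inequality. -/
theorem isSubgradientOn_univ_iff {f : E → ℝ} {x p : E} :
    IsSubgradientOn f univ x p ↔ p ∈ conjDom f ∧ conjReal f p ≤ inner ℝ x p - f x := by
  have hiff : ∀ y, f x + inner ℝ p (y - x) ≤ f y ↔ inner ℝ y p - f y ≤ inner ℝ x p - f x := by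
    intro y
    rw [inner_sub_right, real_inner_comm, real_inner_comm x]
    constructor <;> intro h <;> linarith
  refine ⟨fun h => ?_, fun ⟨hp, h⟩ y _ => (hiff y).2 ((inner_sub_le_conjReal hp y).trans h)⟩
  have hle : ∀ y, inner ℝ y p - f y ≤ inner ℝ x p - f x := fun y => (hiff y).1 (h y trivial)
  exact ⟨⟨_, forall_mem_range.2 hle⟩, ciSup_le hle⟩

variable [CompleteSpace E] {σ : E → ℝ} {p q y : E}

theorem IsSubgradientOn.eq_gradient_of_conjReal (hσ : DifferentiableAt ℝ σ y)
    (hσc : ConvexOn ℝ univ σ) (hp : p ∈ conjDom σ)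
    (h : IsSubgradientOn (conjReal σ) (conjDom σ) p y) : p = ∇ σ y := by
  obtain ⟨hmem, hconj⟩ := isSubgradientOn_univ_iff.1
    (isSubgradientOn_of_hasGradientAt hσc (mem_univ y) hσ.hasGradientAt)
  have hsub := h _ hmem
  rw [inner_sub_right] at hsub
  have hp' : IsSubgradientOn σ univ y p := isSubgradientOn_univ_iff.2 ⟨hp, by linarith⟩
  exact hp'.eq_of_hasGradientAt univ_mem hσ.hasGradientAt

/-- Differentiability of `σ` makes its conjugate strictly convex along subgradients. -/
theorem IsSubgradientOn.add_inner_lt_conjReal (hσ : DifferentiableAt ℝ σ y)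
    (hσc : ConvexOn ℝ univ σ) (hp : p ∈ conjDom σ)
    (h : IsSubgradientOn (conjReal σ) (conjDom σ) p y) (hq : q ∈ conjDom σ) (hqp : q ≠ p) :
    conjReal σ p + inner ℝ y (q - p) < conjReal σ q := by
  refine (h q hq).lt_of_ne fun heq => hqp ?_
  have h' : IsSubgradientOn (conjReal σ) (conjDom σ) q y := by
    intro r hr
    rw [← heq, add_assoc, ← inner_add_right, add_comm (q - p), sub_add_sub_cancel]
    exact h r hr
  rw [h'.eq_gradient_of_conjReal hσ hσc hq, h.eq_gradient_of_conjReal hσ hσc hp]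

end Conjugate

section Maximizer

variable {E : Type*} [NormedAddCommGroup E] [InnerProductSpace ℝ E]

/-- The function `q ↦ ⟨x, q⟩ - J q - σ* q` maximized in the Hopf formula, where `J` stands for the
time integral of the Hamiltonian; it is meaningful on `conjDom σ` only. -/
noncomputable def score (σ J : E → ℝ) (x q : E) : ℝ := inner ℝ x q - J q - conjReal σ q

/-- `p` maximizes `q ↦ ⟨x, q⟩ - J q - σ* q`. -/
def IsMaximizer (σ J : E → ℝ) (x p : E) : Prop :=
  p ∈ conjDom σ ∧ IsMaxOn (score σ J x) (conjDom σ) p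

/-- `p` is the only maximizer of `q ↦ ⟨x, q⟩ - J q - σ* q`. -/
def IsUniqueMaximizer (σ J : E → ℝ) (x p : E) : Prop :=
  p ∈ conjDom σ ∧ ∀ q ∈ conjDom σ, q ≠ p → score σ J x q < score σ J x p

variable {σ J J₀ J₁ : E → ℝ} {x p : E}

theorem IsUniqueMaximizer.isMaximizer (h : IsUniqueMaximizer σ J x p) : IsMaximizer σ J x p := by
  refine ⟨h.1, fun q hq => ?_⟩
  rcases eq_or_ne q p with rfl | hqp
  exacts [le_refl (score σ J x q), (h.2 q hq hqp).le]

theorem IsMaximizer.isUniqueMaximizer (h : IsMaximizer σ J x p)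
    (huniq : ∀ q, IsMaximizer σ J x q → q = p) : IsUniqueMaximizer σ J x p :=
  ⟨h.1, fun q hq hqp => (h.2 hq).lt_of_ne fun heq =>
    hqp (huniq q ⟨hq, fun _ hr => (h.2 hr).trans_eq heq.symm⟩)⟩

variable [CompleteSpace E]

theorem IsMaximizer.isSubgradientOn_conjReal (h : IsMaximizer σ J x p)
    (hJ : DifferentiableAt ℝ J p) :
    IsSubgradientOn (conjReal σ) (conjDom σ) p (x - ∇ J p) := by
  refine isSubgradientOn_of_isMaxOn_sub (convexOn_conjReal σ) h.1 ?_ h.2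
  rw [hasGradientAt_iff_hasFDerivAt, map_sub, toDual_gradient]
  exact (InnerProductSpace.toDual ℝ E x).hasFDerivAt.sub hJ.hasFDerivAt

theorem IsMaximizer.isUniqueMaximizer_of_convexOn (hσ : Differentiable ℝ σ)
    (hσc : ConvexOn ℝ univ σ) (hJ : DifferentiableAt ℝ J p) (hJc : ConvexOn ℝ univ J)
    (h : IsMaximizer σ J x p) : IsUniqueMaximizer σ J x p := by
  refine ⟨h.1, fun q hq hqp => ?_⟩
  have hs := (h.isSubgradientOn_conjReal hJ).add_inner_lt_conjReal (hσ _) hσc h.1 hq hqp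
  have hJq := isSubgradientOn_of_hasGradientAt hJc (mem_univ p) hJ.hasGradientAt q trivial
  simp only [score, inner_sub_left, inner_sub_right] at *
  linarith

/-- The point `x + ∇ (J₁ - J₀) p` is where the characteristic carrying the momentum `p` from `x`
arrives at the later time. -/
theorem IsUniqueMaximizer.of_concaveOn_sub (hJ : DifferentiableAt ℝ (J₁ - J₀) p)
    (hc : ConcaveOn ℝ univ (J₁ - J₀)) (h : IsUniqueMaximizer σ J₁ (x + ∇ (J₁ - J₀) p) p) :
    IsUniqueMaximizer σ J₀ x p := by
  refine ⟨h.1, fun q hq hqp => ?_⟩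
  have hneg : HasGradientAt (-(J₁ - J₀)) (-∇ (J₁ - J₀) p) p := by
    rw [hasGradientAt_iff_hasFDerivAt, map_neg, toDual_gradient]
    exact hJ.hasFDerivAt.neg
  have hinc := isSubgradientOn_of_hasGradientAt hc.neg (mem_univ p) hneg q trivial
  have hlt := h.2 q hq hqp
  simp only [score, inner_add_left, inner_neg_left, inner_sub_right, Pi.neg_apply,
    Pi.sub_apply] at *
  linarith

/-- The score gap for `J₀` is a convex combination of the score gap for `J₁` and the gap in the
subgradient inequality for `σ*`. -/
theorem IsUniqueMaximizer.of_proportional {c : ℝ} (hσ : Differentiable ℝ σ)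
    (hσc : ConvexOn ℝ univ σ) (hJ₁ : DifferentiableAt ℝ J₁ p) (hc : c ∈ Icc 0 1)
    (hJ : ∀ q, J₀ q - J₀ p = c * (J₁ q - J₁ p))
    (h : IsUniqueMaximizer σ J₁ (x + ∇ (J₁ - J₀) p) p) : IsUniqueMaximizer σ J₀ x p := by
  refine ⟨h.1, fun q hq hqp => ?_⟩
  have hgrad : ∇ (J₁ - J₀) p = (1 - c) • ∇ J₁ p := by
    have heq : J₁ - J₀ = fun q => (1 - c) * J₁ q - (J₀ p - c * J₁ p) := by
      funext q
      simp only [Pi.sub_apply]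
      linear_combination -hJ q
    refine HasGradientAt.gradient ?_
    rw [heq, hasGradientAt_iff_hasFDerivAt, map_smul, toDual_gradient]
    exact (hJ₁.hasFDerivAt.const_mul (1 - c)).sub_const _
  have hconj := (h.isMaximizer.isSubgradientOn_conjReal hJ₁).add_inner_lt_conjReal
    (hσ _) hσc h.1 hq hqp
  have hscore := h.2 q hq hqp
  have hcomb : score σ J₀ x q - score σ J₀ x p =
      (1 - c) * (conjReal σ p + inner ℝ (x + ∇ (J₁ - J₀) p - ∇ J₁ p) (q - p) - conjReal σ q) +
      c * (score σ J₁ (x + ∇ (J₁ - J₀) p) q - score σ J₁ (x + ∇ (J₁ - J₀) p) p) := by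
    simp only [score, hgrad, inner_add_left, inner_sub_left, inner_sub_right,
      real_inner_smul_left]
    linear_combination -hJ q
  have hneg := (convex_Iio (0 : ℝ)) (sub_neg.2 hconj) (sub_neg.2 hscore)
    (sub_nonneg.2 hc.2) hc.1 (sub_add_cancel 1 c)
  exact sub_neg.1 (hcomb.trans_lt hneg)

end Maximizer

section ExtendedScore

variable {n : ℕ} {σ J v F : EuclideanSpace ℝ (Fin n) → ℝ} {x x₀ p q : EuclideanSpace ℝ (Fin n)}
  {K : Set (EuclideanSpace ℝ (Fin n))}

theorem fenchelConj_of_mem (hq : q ∈ conjDom σ) : fenchelConj σ q = (conjReal σ q : EReal) :=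
  (EReal.coe_strictMono.monotone.map_ciSup_of_continuousAt
    continuous_coe_real_ereal.continuousAt hq).symm

theorem fenchelConj_of_notMem (hq : q ∉ conjDom σ) : fenchelConj σ q = ⊤ := by
  refine (EReal.eq_top_iff_forall_lt _).2 fun c => ?_
  obtain ⟨_, ⟨x, rfl⟩, hx⟩ := not_bddAbove_iff.1 hq c
  exact (EReal.coe_lt_coe_iff.2 hx).trans_le
    (le_iSup (fun x => ((inner ℝ x q - σ x : ℝ) : EReal)) x)

/-- The function `q ↦ ⟨x, q⟩ - J q - σ* q` with values in the extended reals, defined for every `q`;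
`phi H σ t x` is the case `J = ∫₀ᵗ H`. -/
noncomputable def extScore (σ J : EuclideanSpace ℝ (Fin n) → ℝ) (x q : EuclideanSpace ℝ (Fin n)) :
    EReal := ((inner ℝ x q - J q : ℝ) : EReal) - fenchelConj σ q

theorem extScore_of_mem (hq : q ∈ conjDom σ) : extScore σ J x q = (score σ J x q : EReal) := by
  rw [extScore, fenchelConj_of_mem hq, ← EReal.coe_sub, score]

theorem extScore_of_notMem (hq : q ∉ conjDom σ) : extScore σ J x q = ⊥ := by
  rw [extScore, fenchelConj_of_notMem hq, EReal.sub_top]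

theorem mem_conjDom_of_isMaxOn_extScore (hK : (K ∩ conjDom σ).Nonempty)
    (h : IsMaxOn (extScore σ J x) K p) : p ∈ conjDom σ := by
  obtain ⟨q, hqK, hq⟩ := hK
  by_contra hp
  have hle : extScore σ J x q ≤ extScore σ J x p := h hqK
  rw [extScore_of_mem hq, extScore_of_notMem hp] at hle
  exact (EReal.bot_lt_coe _).not_ge hle

theorem isMaxOn_extScore_iff (hp : p ∈ conjDom σ) :
    IsMaxOn (extScore σ J x) K p ↔ IsMaxOn (score σ J x) (K ∩ conjDom σ) p := by
  simp only [isMaxOn_iff]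
  refine ⟨fun h q hq => ?_, fun h q hqK => ?_⟩
  · simpa [extScore_of_mem hp, extScore_of_mem hq.2] using h q hq.1
  · by_cases hq : q ∈ conjDom σ
    · simpa [extScore_of_mem hp, extScore_of_mem hq] using h q ⟨hqK, hq⟩
    · simp [extScore_of_notMem hq]

theorem lowerSemicontinuous_fenchelConj (σ : EuclideanSpace ℝ (Fin n) → ℝ) :
    LowerSemicontinuous (fenchelConj σ) :=
  lowerSemicontinuous_iSup fun x => Continuous.lowerSemicontinuous
    (continuous_coe_real_ereal.comp (by fun_prop))

theorem upperSemicontinuousWithinAt_coe_sub_fenchelConj {Z : Type*} [TopologicalSpace Z]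
    {a : Z → ℝ} {b : Z → EuclideanSpace ℝ (Fin n)} {s : Set Z} {z : Z}
    (ha : ContinuousWithinAt a s z) (hb : ContinuousWithinAt b s z) :
    UpperSemicontinuousWithinAt (fun z => (a z : EReal) - fenchelConj σ (b z)) s z := by
  have hneg : UpperSemicontinuousWithinAt (fun z => -fenchelConj σ (b z)) s z :=
    continuous_neg.continuousAt.comp_lowerSemicontinuousWithinAt_antitone
      (fun y hy => hb.eventually (lowerSemicontinuous_fenchelConj σ (b z) y hy))
      EReal.neg_strictAnti.antitone
  simp only [sub_eq_add_neg]
  exact (continuous_coe_real_ereal.continuousAt.comp_continuousWithinAt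
    ha).upperSemicontinuousWithinAt.add' hneg
    (EReal.continuousAt_add (Or.inl (EReal.coe_ne_top _)) (Or.inl (EReal.coe_ne_bot _)))

theorem exists_isMaxOn_extScore (hK : IsCompact K) (hKne : K.Nonempty) (hJ : ContinuousOn J K) :
    ∃ p ∈ K, IsMaxOn (extScore σ J x) K p :=
  UpperSemicontinuousOn.exists_isMaxOn hKne hK fun q hq =>
    upperSemicontinuousWithinAt_coe_sub_fenchelConj
      (Continuous.continuousWithinAt (by fun_prop) |>.sub (hJ q hq)) continuousWithinAt_id

/-- A point `p` maximizing `⟨x₀, ·⟩ + F - v*` over `K` works, since a subgradient of `v` at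
`x₀ + ∇ F p` that lies in `K` gives equality in the Fenchel–Young inequality at `p`. -/
theorem exists_isSubgradientOn_add_gradient (hK : IsCompact K) (hKc : Convex ℝ K)
    (hKne : K.Nonempty) (hF : ∀ p ∈ K, DifferentiableAt ℝ F p)
    (hsub : ∀ p ∈ K, ∃ m ∈ K, IsSubgradientOn v univ (x₀ + ∇ F p) m) :
    ∃ p ∈ K, IsSubgradientOn v univ (x₀ + ∇ F p) p := by
  have hne : (K ∩ conjDom v).Nonempty := by
    obtain ⟨q, hq⟩ := hKne
    obtain ⟨m, hmK, hm⟩ := hsub q hq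
    exact ⟨m, hmK, (isSubgradientOn_univ_iff.1 hm).1⟩
  obtain ⟨p, hpK, hmax⟩ := exists_isMaxOn_extScore (σ := v) (J := -F) (x := x₀) hK hKne
    fun q hq => (hF q hq).continuousAt.neg.continuousWithinAt
  have hp := mem_conjDom_of_isMaxOn_extScore hne hmax
  obtain ⟨m, hmK, hm⟩ := hsub p hpK
  obtain ⟨hmdom, hmconj⟩ := isSubgradientOn_univ_iff.1 hm
  have hgrad : HasGradientAt (fun q => inner ℝ x₀ q - (-F) q) (x₀ + ∇ F p) p := by
    rw [hasGradientAt_iff_hasFDerivAt, map_add, toDual_gradient]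
    simp only [Pi.neg_apply, sub_neg_eq_add]
    exact (InnerProductSpace.toDual ℝ _ x₀).hasFDerivAt.add (hF p hpK).hasFDerivAt
  have hle := isSubgradientOn_of_isMaxOn_sub
    ((convexOn_conjReal v).subset inter_subset_right (hKc.inter (convexOn_conjReal v).1))
    ⟨hpK, hp⟩ hgrad ((isMaxOn_extScore_iff hp).1 hmax) m ⟨hmK, hmdom⟩
  rw [inner_sub_right] at hle
  exact ⟨p, hpK, isSubgradientOn_univ_iff.2 ⟨hp, by linarith⟩⟩

end ExtendedScore

section Primitive

variable {E : Type*} [NormedAddCommGroup E] {H : ℝ → E → ℝ} {T a b t t₀ : ℝ} {p q : E}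

/-- The time integral `∫₀ᵗ H(τ, q) dτ` of the Hamiltonian. -/
noncomputable def primitive (H : ℝ → E → ℝ) (t : ℝ) (q : E) : ℝ := ∫ τ in (0 : ℝ)..t, H τ q

theorem intervalIntegrable_of_continuousOn_prod
    (hH : ContinuousOn (Function.uncurry H) (Ico 0 T ×ˢ univ)) (ha : a ∈ Ico 0 T)
    (hb : b ∈ Ico 0 T) (q : E) : IntervalIntegrable (fun τ => H τ q) volume a b :=
  ((hH.uncurry_right q (mem_univ q)).mono
    (OrdConnected.uIcc_subset ordConnected_Ico ha hb)).intervalIntegrable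

theorem primitive_sub_primitive (hH : ContinuousOn (Function.uncurry H) (Ico 0 T ×ˢ univ))
    (ha : a ∈ Ico 0 T) (hb : b ∈ Ico 0 T) (q : E) :
    primitive H b q - primitive H a q = ∫ τ in a..b, H τ q :=
  have h0 : (0 : ℝ) ∈ Ico 0 T := ⟨le_rfl, ha.1.trans_lt ha.2⟩
  intervalIntegral.integral_interval_sub_left
    (intervalIntegrable_of_continuousOn_prod hH h0 hb q)
    (intervalIntegrable_of_continuousOn_prod hH h0 ha q)

theorem continuous_primitive (hH : ContinuousOn (Function.uncurry H) (Ico 0 T ×ˢ univ))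
    (ht : t ∈ Ico 0 T) : Continuous (primitive H t) := by
  have hclamp : primitive H t = fun q => ∫ τ in (0 : ℝ)..t, H (projIcc 0 t ht.1 τ) q := by
    funext q
    refine intervalIntegral.integral_congr fun τ hτ => ?_
    rw [uIcc_of_le ht.1] at hτ
    simp only [projIcc_of_mem ht.1 hτ]
  rw [hclamp]
  refine intervalIntegral.continuous_parametric_intervalIntegral_of_continuous'
    (f := fun q τ => H (projIcc 0 t ht.1 τ) q) (hH.comp_continuous
      (f := fun w : E × ℝ => ((projIcc 0 t ht.1 w.2 : ℝ), w.1)) (by fun_prop) fun w => ?_) 0 t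
  exact ⟨⟨(projIcc 0 t ht.1 w.2).2.1, (projIcc 0 t ht.1 w.2).2.2.trans_lt ht.2⟩, mem_univ _⟩

theorem primitive_sub_isLittleO (hH : ContinuousOn (Function.uncurry H) (Ico 0 T ×ˢ univ))
    (ht₀ : t₀ ∈ Ioo 0 T) (p : E) :
    (fun w : ℝ × E => primitive H w.1 w.2 - primitive H t₀ w.2 - (w.1 - t₀) * H t₀ p)
      =o[𝓝 (t₀, p)] fun w => w.1 - t₀ := by
  have hcont : ContinuousAt (Function.uncurry H) (t₀, p) :=
    hH.continuousAt (prod_mem_nhds (Ico_mem_nhds ht₀.1 ht₀.2) univ_mem)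
  refine isLittleO_iff.2 fun c hc => ?_
  obtain ⟨η, hη, hHη⟩ := Metric.continuousAt_iff.1 hcont c hc
  filter_upwards [ball_mem_nhds (t₀, p) hη,
    prod_mem_nhds (Ioo_mem_nhds ht₀.1 ht₀.2) (univ_mem (f := 𝓝 p))] with ⟨t, q⟩ hball ⟨ht, _⟩
  have hint := intervalIntegrable_of_continuousOn_prod hH (Ioo_subset_Ico_self ht₀)
    (Ioo_subset_Ico_self ht) q
  have hval : primitive H t q - primitive H t₀ q - (t - t₀) * H t₀ p =
      ∫ τ in t₀..t, (H τ q - H t₀ p) := by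
    rw [primitive_sub_primitive hH (Ioo_subset_Ico_self ht₀) (Ioo_subset_Ico_self ht),
      intervalIntegral.integral_sub hint intervalIntegrable_const,
      intervalIntegral.integral_const, smul_eq_mul]
  rw [hval, Real.norm_eq_abs (t - t₀)]
  refine intervalIntegral.norm_integral_le_of_norm_le_const fun τ hτ => ?_
  rw [mem_ball, Prod.dist_eq, max_lt_iff] at hball
  refine (hHη (x := (τ, q)) (max_lt ?_ hball.2)).le
  exact (abs_sub_left_of_mem_uIcc (uIoc_subset_uIcc hτ)).trans_lt hball.1

theorem continuousAt_primitive_prod (hH : ContinuousOn (Function.uncurry H) (Ico 0 T ×ˢ univ))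
    (ht₀ : t₀ ∈ Ioo 0 T) (p : E) :
    ContinuousAt (fun w : ℝ × E => primitive H w.1 w.2) (t₀, p) := by
  have htime : Tendsto (fun w : ℝ × E => w.1 - t₀) (𝓝 (t₀, p)) (𝓝 0) :=
    Continuous.tendsto' (by fun_prop) _ _ (by simp)
  have hrest := (((primitive_sub_isLittleO hH ht₀ p).trans_tendsto htime).add
    (htime.mul_const (H t₀ p))).add
    ((continuous_primitive hH (Ioo_subset_Ico_self ht₀)).continuousAt.comp
      (x := (t₀, p)) continuousAt_snd).tendsto
  rw [ContinuousAt]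
  simpa using hrest

end Primitive

section Value

variable {n : ℕ} {H : ℝ → EuclideanSpace ℝ (Fin n) → ℝ} {σ : EuclideanSpace ℝ (Fin n) → ℝ}
  {T t t₀ : ℝ} {x x₀ p : EuclideanSpace ℝ (Fin n)}

theorem phi_eq_extScore (t : ℝ) (x : EuclideanSpace ℝ (Fin n)) :
    phi H σ t x = extScore σ (primitive H t) x := rfl

theorem isMaxOn_phi_univ_iff (hp : p ∈ conjDom σ) :
    IsMaxOn (phi H σ t x) univ p ↔ IsMaxOn (score σ (primitive H t) x) (conjDom σ) p := by
  rw [phi_eq_extScore, isMaxOn_extScore_iff hp, univ_inter]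

theorem IsMaximizer.hopf_eq (h : IsMaximizer σ (primitive H t) x p) :
    hopf H σ t x = score σ (primitive H t) x p := by
  have hmax := (isMaxOn_phi_univ_iff h.1).2 h.2
  have hsup : ⨆ q, phi H σ t x q = phi H σ t x p :=
    le_antisymm (iSup_le fun q => hmax (mem_univ q)) (le_iSup (phi H σ t x) p)
  rw [hopf, hsup, phi_eq_extScore, extScore_of_mem h.1, EReal.toReal_coe]

theorem IsMaximizer.isSubgradientOn_hopf (h : IsMaximizer σ (primitive H t) x p)
    (hex : ∀ y, ∃ q, IsMaximizer σ (primitive H t) y q) :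
    IsSubgradientOn (hopf H σ t) univ x p := by
  intro y _
  obtain ⟨q, hq⟩ := hex y
  have hle : score σ (primitive H t) y p ≤ score σ (primitive H t) y q := hq.2 h.1
  rw [h.hopf_eq, hq.hopf_eq, inner_sub_right, real_inner_comm, real_inner_comm x]
  simp only [score] at *
  linarith

theorem Compatible.eventually_exists_isMaximizer (hA1 : Compatible T H σ)
    (hH : ContinuousOn (Function.uncurry H) (Ico 0 T ×ˢ univ)) (hσ : (conjDom σ).Nonempty)
    (ht₀ : t₀ ∈ Ioo 0 T) (x₀ : EuclideanSpace ℝ (Fin n)) :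
    ∃ N > 0, ∀ᶠ z : ℝ × EuclideanSpace ℝ (Fin n) in 𝓝 (t₀, x₀),
      ∃ p ∈ closedBall 0 N, IsMaximizer σ (primitive H z.1) z.2 p := by
  obtain ⟨r, hr, N, hN, hA⟩ := hA1 t₀ (Ioo_subset_Ico_self ht₀) x₀
  have hnear : ∀ᶠ z : ℝ × EuclideanSpace ℝ (Fin n) in 𝓝 (t₀, x₀),
      |z.1 - t₀| + ‖z.2 - x₀‖ < r :=
    (isOpen_lt (by fun_prop) continuous_const).mem_nhds (by simpa using hr)
  refine ⟨N, hN, ?_⟩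
  filter_upwards [hnear, prod_mem_nhds (Ico_mem_nhds ht₀.1 ht₀.2) univ_mem]
    with ⟨t, x⟩ hz ⟨ht, _⟩
  obtain ⟨p, hpN, hmax⟩ := exists_isMaxOn_extScore (σ := σ) (x := x)
    (isCompact_closedBall (0 : EuclideanSpace ℝ (Fin n)) N) (nonempty_closedBall.2 hN.le)
    (continuous_primitive hH ht).continuousOn
  have hglobal : IsMaxOn (phi H σ t x) univ p := by
    intro q _
    by_cases hq : q ∈ closedBall 0 N
    · exact hmax hq
    · rw [mem_closedBall_zero_iff, not_le] at hq
      exact (hA t ht x q hz hq).le.trans (iSup₂_le fun q hq => hmax hq)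
  have hp : p ∈ conjDom σ := mem_conjDom_of_isMaxOn_extScore (by rwa [univ_inter]) hglobal
  exact ⟨p, hpN, hp, (isMaxOn_phi_univ_iff hp).1 hglobal⟩

theorem Compatible.exists_isMaximizer (hA1 : Compatible T H σ)
    (hH : ContinuousOn (Function.uncurry H) (Ico 0 T ×ˢ univ)) (hσ : (conjDom σ).Nonempty)
    (ht : t ∈ Ioo 0 T) (x : EuclideanSpace ℝ (Fin n)) :
    ∃ p, IsMaximizer σ (primitive H t) x p :=
  have ⟨_, _, hev⟩ := hA1.eventually_exists_isMaximizer hH hσ ht x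
  hev.self_of_nhds.imp fun _ hp => hp.2

end Value

section Envelope

theorem eventually_forall_mem_of_le {Z Q R : Type*} [TopologicalSpace Z] [TopologicalSpace Q]
    [LinearOrder R] [DenselyOrdered R] {f : Z → Q → R} {K U : Set Q} {z₀ : Z} {p : Q}
    (hK : IsCompact K) (husc : ∀ q ∈ K, UpperSemicontinuousAt (Function.uncurry f) (z₀, q))
    (hlsc : LowerSemicontinuousAt (fun z => f z p) z₀) (hlt : ∀ q ∈ K, q ≠ p → f z₀ q < f z₀ p)
    (hU : U ∈ 𝓝 p) : ∀ᶠ z in 𝓝 z₀, ∀ q ∈ K, f z p ≤ f z q → q ∈ U := by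
  refine hK.eventually_forall_of_forall_eventually fun q hq => ?_
  rcases eq_or_ne q p with rfl | hqp
  · exact (continuous_snd.continuousAt.eventually_mem hU).mono fun _ hz _ => hz
  · obtain ⟨c, hqc, hcp⟩ := exists_between (hlt q hq hqp)
    filter_upwards [husc q hq c hqc, continuous_fst.continuousAt.eventually (hlsc c hcp)]
      with z hzq hzp hle
    exact absurd (hzq.trans hzp) hle.not_gt

theorem hasFDerivAt_of_isLittleO_of_maximizers {Z Q : Type*} [NormedAddCommGroup Z]
    [NormedSpace ℝ Z] [TopologicalSpace Q] {f : Z → Q → ℝ} {u : Z → ℝ} {L : Z →L[ℝ] ℝ} {z₀ : Z}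
    {p : Q}
    (hf : (fun w : Z × Q => f w.1 w.2 - f z₀ w.2 - L (w.1 - z₀)) =o[𝓝 (z₀, p)] fun w => w.1 - z₀)
    (hp : u z₀ = f z₀ p) (hle : ∀ᶠ z in 𝓝 z₀, f z p ≤ u z)
    (hmax : ∀ U ∈ 𝓝 p, ∀ᶠ z in 𝓝 z₀, ∃ q ∈ U, u z = f z q ∧ f z₀ q ≤ u z₀) :
    HasFDerivAt u L z₀ := by
  refine hasFDerivAt_iff_isLittleO.2 (isLittleO_iff.2 fun c hc => ?_)
  obtain ⟨V, hV, U, hU, hVU⟩ := mem_nhds_prod_iff.1 (isLittleO_iff.1 hf hc)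
  filter_upwards [hV, hle, hmax U hU] with z hz hzp ⟨q, hqU, hzq, hq⟩
  have hbound : ∀ r ∈ U, |f z r - f z₀ r - L (z - z₀)| ≤ c * ‖z - z₀‖ :=
    fun r hr => hVU (mk_mem_prod hz hr)
  have hupper := (abs_le.1 (hbound q hqU)).2
  have hlower := (abs_le.1 (hbound p (mem_of_mem_nhds hU))).1
  exact abs_le.2 ⟨by linarith, by linarith⟩

variable {n : ℕ} {H : ℝ → EuclideanSpace ℝ (Fin n) → ℝ} {σ : EuclideanSpace ℝ (Fin n) → ℝ}
  {T t₀ N : ℝ} {x₀ p : EuclideanSpace ℝ (Fin n)}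

theorem upperSemicontinuousAt_phi (hH : ContinuousOn (Function.uncurry H) (Ico 0 T ×ˢ univ))
    (ht₀ : t₀ ∈ Ioo 0 T) (x₀ q : EuclideanSpace ℝ (Fin n)) :
    UpperSemicontinuousAt (fun w : (ℝ × EuclideanSpace ℝ (Fin n)) × EuclideanSpace ℝ (Fin n) =>
      phi H σ w.1.1 w.1.2 w.2) ((t₀, x₀), q) := by
  have hJ : ContinuousAt (fun w : (ℝ × EuclideanSpace ℝ (Fin n)) × EuclideanSpace ℝ (Fin n) =>
      primitive H w.1.1 w.2) ((t₀, x₀), q) :=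
    (continuousAt_primitive_prod hH ht₀ q).comp_of_eq
      (f := fun w : (ℝ × EuclideanSpace ℝ (Fin n)) × EuclideanSpace ℝ (Fin n) => (w.1.1, w.2))
      (by fun_prop) rfl
  have hscore : ContinuousAt
      (fun w : (ℝ × EuclideanSpace ℝ (Fin n)) × EuclideanSpace ℝ (Fin n) =>
        inner ℝ w.1.2 w.2 - primitive H w.1.1 w.2) ((t₀, x₀), q) :=
    ContinuousAt.sub (by fun_prop) hJ
  exact upperSemicontinuousWithinAt_univ_iff.1 (upperSemicontinuousWithinAt_coe_sub_fenchelConj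
    hscore.continuousWithinAt continuousWithinAt_snd)

theorem continuousAt_phi (hH : ContinuousOn (Function.uncurry H) (Ico 0 T ×ˢ univ))
    (ht₀ : t₀ ∈ Ioo 0 T) (x₀ : EuclideanSpace ℝ (Fin n)) (hp : p ∈ conjDom σ) :
    ContinuousAt (fun z : ℝ × EuclideanSpace ℝ (Fin n) => phi H σ z.1 z.2 p) (t₀, x₀) := by
  have hJ : ContinuousAt (fun z : ℝ × EuclideanSpace ℝ (Fin n) => primitive H z.1 p) (t₀, x₀) :=
    (continuousAt_primitive_prod hH ht₀ p).comp_of_eq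
      (f := fun z : ℝ × EuclideanSpace ℝ (Fin n) => (z.1, p)) (by fun_prop) rfl
  simp only [phi_eq_extScore, extScore_of_mem hp, score]
  exact continuous_coe_real_ereal.continuousAt.comp (by fun_prop)

theorem score_primitive_sub_isLittleO (σ : EuclideanSpace ℝ (Fin n) → ℝ)
    (hH : ContinuousOn (Function.uncurry H) (Ico 0 T ×ˢ univ))
    (ht₀ : t₀ ∈ Ioo 0 T) (x₀ p : EuclideanSpace ℝ (Fin n)) :
    (fun w : (ℝ × EuclideanSpace ℝ (Fin n)) × EuclideanSpace ℝ (Fin n) =>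
      score σ (primitive H w.1.1) w.1.2 w.2 - score σ (primitive H t₀) x₀ w.2 -
        (inner ℝ p (w.1.2 - x₀) - (w.1.1 - t₀) * H t₀ p))
      =o[𝓝 ((t₀, x₀), p)] fun w => w.1 - (t₀, x₀) := by
  have hspace : (fun w : (ℝ × EuclideanSpace ℝ (Fin n)) × EuclideanSpace ℝ (Fin n) =>
      inner ℝ (w.2 - p) (w.1.2 - x₀)) =o[𝓝 ((t₀, x₀), p)] fun w => w.1 - (t₀, x₀) := by
    refine isLittleO_iff.2 fun c hc => ?_
    filter_upwards [continuous_snd.continuousAt.eventually_mem (closedBall_mem_nhds p hc)]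
      with w hw
    rw [mem_closedBall_iff_norm] at hw
    calc ‖inner ℝ (w.2 - p) (w.1.2 - x₀)‖ ≤ ‖w.2 - p‖ * ‖w.1.2 - x₀‖ := norm_inner_le_norm _ _
      _ ≤ c * ‖w.1 - (t₀, x₀)‖ := by
        gcongr
        exact norm_snd_le (w.1 - (t₀, x₀))
  have htime := ((primitive_sub_isLittleO hH ht₀ p).comp_tendsto
    (k := fun w : (ℝ × EuclideanSpace ℝ (Fin n)) × EuclideanSpace ℝ (Fin n) => (w.1.1, w.2))
    (Continuous.tendsto' (by fun_prop) ((t₀, x₀), p) _ rfl)).trans_isBigO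
    (isBigO_of_le _ fun w => norm_fst_le (w.1 - (t₀, x₀)))
  refine (hspace.sub htime).congr_left fun w => ?_
  simp only [score, Function.comp_apply, inner_sub_left, inner_sub_right, real_inner_comm]
  ring

theorem IsUniqueMaximizer.hasFDerivAt_hopf
    (h : IsUniqueMaximizer σ (primitive H t₀) x₀ p)
    (hH : ContinuousOn (Function.uncurry H) (Ico 0 T ×ˢ univ)) (ht₀ : t₀ ∈ Ioo 0 T)
    (hex : ∀ᶠ z : ℝ × EuclideanSpace ℝ (Fin n) in 𝓝 (t₀, x₀),
      ∃ q ∈ closedBall 0 N, IsMaximizer σ (primitive H z.1) z.2 q) :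
    HasFDerivAt (fun z : ℝ × EuclideanSpace ℝ (Fin n) => hopf H σ z.1 z.2)
      ((innerSL ℝ p).comp (ContinuousLinearMap.snd ℝ ℝ _) -
        (ContinuousLinearMap.fst ℝ ℝ _).smulRight (H t₀ p)) (t₀, x₀) := by
  have hlt : ∀ q, q ≠ p → phi H σ t₀ x₀ q < phi H σ t₀ x₀ p := by
    intro q hqp
    simp only [phi_eq_extScore, extScore_of_mem h.1]
    by_cases hq : q ∈ conjDom σ
    · exact extScore_of_mem hq ▸ EReal.coe_lt_coe_iff.2 (h.2 q hq hqp)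
    · exact extScore_of_notMem hq ▸ EReal.bot_lt_coe _
  have hnear : ∀ U ∈ 𝓝 p, ∀ᶠ z : ℝ × EuclideanSpace ℝ (Fin n) in 𝓝 (t₀, x₀),
      ∀ q ∈ closedBall 0 N, phi H σ z.1 z.2 p ≤ phi H σ z.1 z.2 q → q ∈ U := fun U hU =>
    eventually_forall_mem_of_le (isCompact_closedBall 0 N)
      (fun q _ => upperSemicontinuousAt_phi hH ht₀ x₀ q)
      (continuousAt_phi hH ht₀ x₀ h.1).lowerSemicontinuousAt (fun q _ => hlt q) hU
  refine hasFDerivAt_of_isLittleO_of_maximizers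
    (f := fun z q => score σ (primitive H z.1) z.2 q) (p := p)
    (by simpa using score_primitive_sub_isLittleO σ hH ht₀ x₀ p)
    h.isMaximizer.hopf_eq (hex.mono fun z ⟨q, _, hq⟩ => ?_) fun U hU => ?_
  · rw [hq.hopf_eq]
    exact hq.2 h.1
  · filter_upwards [hex, hnear U hU] with z ⟨q, hqN, hq⟩ hz
    refine ⟨q, hz q hqN ((isMaxOn_phi_univ_iff hq.1).2 hq.2 (mem_univ p)), hq.hopf_eq, ?_⟩
    rw [h.isMaximizer.hopf_eq]
    exact h.isMaximizer.2 hq.1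

end Envelope

section PrimitiveGradient

variable {E : Type*} [NormedAddCommGroup E] {H : ℝ → E → ℝ} {a b : ℝ}

theorem hasFDerivAt_intervalIntegral_of_continuousOn [NormedSpace ℝ E] [ProperSpace E]
    (hH : ContinuousOn (Function.uncurry H) (uIcc a b ×ˢ univ))
    (hd : ∀ τ ∈ uIcc a b, Differentiable ℝ (H τ))
    (hH' : ContinuousOn (fun z : ℝ × E => fderiv ℝ (H z.1) z.2) (uIcc a b ×ˢ univ)) (q : E) :
    HasFDerivAt (fun q => ∫ τ in a..b, H τ q) (∫ τ in a..b, fderiv ℝ (H τ) q) q := by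
  obtain ⟨C, hC⟩ := (isCompact_uIcc.prod (isCompact_closedBall q 1)).exists_bound_of_continuousOn
    (hH'.mono (prod_mono_right (subset_univ _)))
  have hint : ∀ q, IntervalIntegrable (fun τ => H τ q) volume a b := fun q =>
    (hH.uncurry_right q (mem_univ q)).intervalIntegrable
  have hint' : IntervalIntegrable (fun τ => fderiv ℝ (H τ) q) volume a b :=
    (ContinuousOn.uncurry_right (f := fun τ q => fderiv ℝ (H τ) q) q (mem_univ q)
      hH').intervalIntegrable
  exact intervalIntegral.hasFDerivAt_integral_of_dominated_of_fderiv_le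
    (closedBall_mem_nhds q one_pos)
    (Eventually.of_forall fun q => (hint q).def'.aestronglyMeasurable) (hint q)
    hint'.def'.aestronglyMeasurable
    (Eventually.of_forall fun τ hτ y hy => hC (τ, y) ⟨uIoc_subset_uIcc hτ, hy⟩)
    intervalIntegrable_const
    (Eventually.of_forall fun τ hτ y _ => (hd τ (uIoc_subset_uIcc hτ) y).hasFDerivAt)

variable [InnerProductSpace ℝ E] [ProperSpace E] {T t t₀ t₁ ε : ℝ} {K : Set E}

theorem differentiable_primitive (hH : ContinuousOn (Function.uncurry H) (Ico 0 T ×ˢ univ))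
    (hd : ∀ τ ∈ Ico 0 T, Differentiable ℝ (H τ))
    (hH' : ContinuousOn (fun z : ℝ × E => fderiv ℝ (H z.1) z.2) (Ico 0 T ×ˢ univ))
    (ht : t ∈ Ico 0 T) : Differentiable ℝ (primitive H t) := by
  have hsub : uIcc 0 t ⊆ Ico 0 T :=
    OrdConnected.uIcc_subset ordConnected_Ico ⟨le_rfl, ht.1.trans_lt ht.2⟩ ht
  exact fun q => (hasFDerivAt_intervalIntegral_of_continuousOn (hH.mono (prod_mono_left hsub))
    (fun τ hτ => hd τ (hsub hτ)) (hH'.mono (prod_mono_left hsub)) q).differentiableAt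

theorem toDual_gradient_primitive_sub
    (hH : ContinuousOn (Function.uncurry H) (Ico 0 T ×ˢ univ))
    (hd : ∀ τ ∈ Ico 0 T, Differentiable ℝ (H τ))
    (hH' : ContinuousOn (fun z : ℝ × E => fderiv ℝ (H z.1) z.2) (Ico 0 T ×ˢ univ))
    (ht₀ : t₀ ∈ Ico 0 T) (ht₁ : t₁ ∈ Ico 0 T) (q : E) :
    InnerProductSpace.toDual ℝ E (∇ (primitive H t₁ - primitive H t₀) q) =
      ∫ τ in t₀..t₁, fderiv ℝ (H τ) q := by
  have hsub : uIcc t₀ t₁ ⊆ Ico 0 T := OrdConnected.uIcc_subset ordConnected_Ico ht₀ ht₁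
  have hdiff : primitive H t₁ - primitive H t₀ = fun q => ∫ τ in t₀..t₁, H τ q :=
    funext (primitive_sub_primitive hH ht₀ ht₁)
  rw [toDual_gradient, hdiff]
  exact (hasFDerivAt_intervalIntegral_of_continuousOn (hH.mono (prod_mono_left hsub))
    (fun τ hτ => hd τ (hsub hτ)) (hH'.mono (prod_mono_left hsub)) q).fderiv

theorem eventually_norm_gradient_primitive_sub_lt
    (hH : ContinuousOn (Function.uncurry H) (Ico 0 T ×ˢ univ))
    (hd : ∀ τ ∈ Ico 0 T, Differentiable ℝ (H τ))
    (hH' : ContinuousOn (fun z : ℝ × E => fderiv ℝ (H z.1) z.2) (Ico 0 T ×ˢ univ))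
    (ht₀ : t₀ ∈ Ico 0 T) (hK : IsCompact K) (hε : 0 < ε) :
    ∀ᶠ t in 𝓝[>] t₀, ∀ q ∈ K, ‖∇ (primitive H t - primitive H t₀) q‖ < ε := by
  obtain ⟨t₁, ht₁, ht₁T⟩ := exists_between ht₀.2
  have hsub : Icc t₀ t₁ ⊆ Ico 0 T := Icc_subset_Ico ht₀.1 ht₁T
  obtain ⟨C, hC⟩ := (isCompact_Icc.prod hK).exists_bound_of_continuousOn
    (hH'.mono (prod_mono hsub (subset_univ K)))
  have hsmall : ∀ᶠ t in 𝓝[>] t₀, C * |t - t₀| < ε :=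
    mem_nhdsWithin_of_mem_nhds
      ((isOpen_lt (by fun_prop) continuous_const).mem_nhds (by simpa using hε))
  filter_upwards [Ioo_mem_nhdsGT ht₁, hsmall] with t ht htε q hq
  rw [← (InnerProductSpace.toDual ℝ E).norm_map,
    toDual_gradient_primitive_sub hH hd hH' ht₀ (hsub (Ioo_subset_Icc_self ht))]
  refine (intervalIntegral.norm_integral_le_of_norm_le_const fun τ hτ => ?_).trans_lt htε
  rw [uIoc_of_le ht.1.le] at hτ
  exact hC (τ, q) ⟨⟨hτ.1.le, hτ.2.trans ht.2.le⟩, hq⟩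

end PrimitiveGradient

section Trichotomy

theorem convexOn_intervalIntegral {E : Type*} [AddCommGroup E] [Module ℝ E] {H : ℝ → E → ℝ}
    {a b : ℝ} {D : Set E} (hab : a ≤ b) (hD : Convex ℝ D)
    (hint : ∀ q ∈ D, IntervalIntegrable (fun τ => H τ q) volume a b)
    (hc : ∀ τ ∈ Ioo a b, ConvexOn ℝ D (H τ)) : ConvexOn ℝ D fun q => ∫ τ in a..b, H τ q := by
  refine ⟨hD, fun p hp q hq r s hr hs hrs => ?_⟩
  simp only [smul_eq_mul]
  rw [← intervalIntegral.integral_const_mul, ← intervalIntegral.integral_const_mul,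
    ← intervalIntegral.integral_add ((hint p hp).const_mul r) ((hint q hq).const_mul s)]
  exact intervalIntegral.integral_mono_on_of_le_Ioo hab (hint _ (hD hp hq hr hs hrs))
    (((hint p hp).const_mul r).add ((hint q hq).const_mul s))
    fun τ hτ => (hc τ hτ).2 hp hq hr hs hrs

variable {E : Type*} [NormedAddCommGroup E] {H : ℝ → E → ℝ} {g k : ℝ → ℝ} {h : E → ℝ}
  {T a b t₀ t₁ : ℝ}

theorem integral_sub_integral_of_separated
    (hH : ContinuousOn (Function.uncurry H) (Ico 0 T ×ˢ univ))
    (hgh : ∀ t ∈ Ioo 0 T, ∀ p, H t p = g t * h p + k t) (ha : a ∈ Ico 0 T) (hb : b ∈ Ico 0 T)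
    (hab : a ≤ b) (p q : E) :
    (∫ τ in a..b, H τ q) - ∫ τ in a..b, H τ p = (∫ τ in a..b, g τ) * (h q - h p) := by
  rw [← intervalIntegral.integral_sub (intervalIntegrable_of_continuousOn_prod hH ha hb q)
    (intervalIntegrable_of_continuousOn_prod hH ha hb p), ← intervalIntegral.integral_mul_const]
  refine intervalIntegral.integral_congr_Ioo_of_le hab fun τ hτ => ?_
  have hτT : τ ∈ Ioo 0 T := ⟨ha.1.trans_lt hτ.1, hτ.2.trans hb.2⟩
  simp only [hgh τ hτT]
  ring

theorem exists_primitive_proportional_of_separated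
    (hH : ContinuousOn (Function.uncurry H) (Ico 0 T ×ˢ univ))
    (hgh : ∀ t ∈ Ioo 0 T, ∀ p, H t p = g t * h p + k t)
    (hg : (∀ t ∈ Ioo 0 T, 0 ≤ g t) ∨ ∀ t ∈ Ioo 0 T, g t ≤ 0) (ht₀ : t₀ ∈ Ico 0 T)
    (ht₁ : t₁ ∈ Ico 0 T) (h01 : t₀ ≤ t₁) :
    ∃ c ∈ Icc (0 : ℝ) 1, ∀ p q, primitive H t₀ q - primitive H t₀ p =
      c * (primitive H t₁ q - primitive H t₁ p) := by
  have h0 : (0 : ℝ) ∈ Ico 0 T := ⟨le_rfl, ht₀.1.trans_lt ht₀.2⟩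
  have hsub₀ : Ioo 0 t₀ ⊆ Ioo 0 T := Ioo_subset_Ioo_right ht₀.2.le
  have hsub₁ : Ioo t₀ t₁ ⊆ Ioo 0 T := Ioo_subset_Ioo ht₀.1 ht₁.2.le
  set A := ∫ τ in (0 : ℝ)..t₀, g τ with hA
  set B := ∫ τ in t₀..t₁, g τ with hB
  have hmem : A ∈ uIcc 0 (A + B) := by
    rw [intervalIntegral.integral_of_le ht₀.1, integral_Ioc_eq_integral_Ioo] at hA
    rw [intervalIntegral.integral_of_le h01, integral_Ioc_eq_integral_Ioo] at hB
    rcases hg with hg | hg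
    · have hA0 : 0 ≤ A := hA ▸ setIntegral_nonneg measurableSet_Ioo fun τ hτ => hg τ (hsub₀ hτ)
      have hB0 : 0 ≤ B := hB ▸ setIntegral_nonneg measurableSet_Ioo fun τ hτ => hg τ (hsub₁ hτ)
      exact mem_uIcc.2 (Or.inl ⟨hA0, le_add_of_nonneg_right hB0⟩)
    · have hA0 : A ≤ 0 := hA ▸ setIntegral_nonpos measurableSet_Ioo fun τ hτ => hg τ (hsub₀ hτ)
      have hB0 : B ≤ 0 := hB ▸ setIntegral_nonpos measurableSet_Ioo fun τ hτ => hg τ (hsub₁ hτ)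
      exact mem_uIcc.2 (Or.inr ⟨add_le_of_nonpos_right hB0, hA0⟩)
  rw [← segment_eq_uIcc, segment_eq_image'] at hmem
  obtain ⟨c, hc, hcA⟩ := hmem
  refine ⟨c, hc, fun p q => ?_⟩
  have hdiff₀ : primitive H t₀ q - primitive H t₀ p = A * (h q - h p) :=
    integral_sub_integral_of_separated hH hgh h0 ht₀ ht₀.1 p q
  have hdiff₁ := integral_sub_integral_of_separated hH hgh ht₀ ht₁ h01 p q
  rw [← primitive_sub_primitive hH ht₀ ht₁, ← primitive_sub_primitive hH ht₀ ht₁] at hdiff₁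
  simp only [zero_add, sub_zero, smul_eq_mul] at hcA
  linear_combination (1 - c) * hdiff₀ - c * hdiff₁ - (h q - h p) * hcA

theorem Structural.convexOn_or_concaveOn_or_proportional {n : ℕ}
    {H : ℝ → EuclideanSpace ℝ (Fin n) → ℝ} (hA2 : Structural T H)
    (hH : ContinuousOn (Function.uncurry H) (Ico 0 T ×ˢ univ)) (ht₀ : t₀ ∈ Ico 0 T)
    (ht₁ : t₁ ∈ Ico 0 T) (h01 : t₀ ≤ t₁) :
    ConvexOn ℝ univ (primitive H t₀) ∨ ConcaveOn ℝ univ (primitive H t₁ - primitive H t₀) ∨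
      ∃ c ∈ Icc (0 : ℝ) 1, ∀ p q, primitive H t₀ q - primitive H t₀ p =
        c * (primitive H t₁ q - primitive H t₁ p) := by
  have h0 : (0 : ℝ) ∈ Ico 0 T := ⟨le_rfl, ht₀.1.trans_lt ht₀.2⟩
  rcases hA2 with (hconv | hconc) | ⟨g, h, k, hgh, hg⟩
  · exact .inl <| convexOn_intervalIntegral ht₀.1 convex_univ
      (fun q _ => intervalIntegrable_of_continuousOn_prod hH h0 ht₀ q)
      fun τ hτ => hconv τ (Ioo_subset_Ioo_right ht₀.2.le hτ)
  · refine .inr (.inl ?_)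
    have hneg : -(primitive H t₁ - primitive H t₀) = fun q => ∫ τ in t₀..t₁, -H τ q := by
      funext q
      rw [Pi.neg_apply, Pi.sub_apply, primitive_sub_primitive hH ht₀ ht₁,
        intervalIntegral.integral_neg]
    rw [← neg_convexOn_iff, hneg]
    exact convexOn_intervalIntegral h01 convex_univ
      (fun q _ => (intervalIntegrable_of_continuousOn_prod hH ht₀ ht₁ q).neg)
      fun τ hτ => (hconc τ (Ioo_subset_Ioo ht₀.1 ht₁.2.le hτ)).neg
  · exact .inr (.inr (exists_primitive_proportional_of_separated hH hgh hg ht₀ ht₁ h01))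

end Trichotomy

section Propagation

variable {n : ℕ} {H : ℝ → EuclideanSpace ℝ (Fin n) → ℝ} {σ F : EuclideanSpace ℝ (Fin n) → ℝ}
  {T t t₀ t₁ : ℝ} {x x₀ : EuclideanSpace ℝ (Fin n)} {K : Set (EuclideanSpace ℝ (Fin n))}

theorem differentiableAt_of_not_isSingular {u : ℝ → EuclideanSpace ℝ (Fin n) → ℝ}
    (ht : t ∈ Ioo 0 T) (h : ¬ IsSingular T u t x) : DifferentiableAt ℝ (u t) x :=
  DifferentiableAt.comp (g := fun z : ℝ × EuclideanSpace ℝ (Fin n) => u z.1 z.2) x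
    (not_not.1 fun hd => h ⟨ht, hd⟩) ((differentiableAt_const t).prodMk differentiableAt_id)

theorem exists_isUniqueMaximizer_add_gradient (hK : IsCompact K) (hKc : Convex ℝ K)
    (hKne : K.Nonempty) (hF : ∀ p ∈ K, DifferentiableAt ℝ F p)
    (hdiff : ∀ p ∈ K, DifferentiableAt ℝ (hopf H σ t) (x₀ + ∇ F p))
    (hex : ∀ y, ∃ q, IsMaximizer σ (primitive H t) y q)
    (hexK : ∀ p ∈ K, ∃ q ∈ K, IsMaximizer σ (primitive H t) (x₀ + ∇ F p) q) :
    ∃ p ∈ K, IsUniqueMaximizer σ (primitive H t) (x₀ + ∇ F p) p := by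
  obtain ⟨p, hpK, hp⟩ := exists_isSubgradientOn_add_gradient hK hKc hKne hF fun p hp =>
    have ⟨m, hmK, hm⟩ := hexK p hp
    ⟨m, hmK, hm.isSubgradientOn_hopf hex⟩
  have huniq : ∀ q, IsMaximizer σ (primitive H t) (x₀ + ∇ F p) q → q = p := fun q hq =>
    ((hq.isSubgradientOn_hopf hex).eq_of_hasGradientAt univ_mem (hdiff p hpK).hasGradientAt).trans
      (hp.eq_of_hasGradientAt univ_mem (hdiff p hpK).hasGradientAt).symm
  obtain ⟨q, hq⟩ := hex (x₀ + ∇ F p)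
  exact ⟨p, hpK, (huniq q hq ▸ hq).isUniqueMaximizer huniq⟩

theorem Structural.exists_isUniqueMaximizer (hA2 : Structural T H)
    (hH : ContinuousOn (Function.uncurry H) (Ico 0 T ×ˢ univ)) (hσ : Differentiable ℝ σ)
    (hσc : ConvexOn ℝ univ σ) (ht₀ : t₀ ∈ Ico 0 T) (ht₁ : t₁ ∈ Ico 0 T) (h01 : t₀ ≤ t₁)
    (hd₀ : Differentiable ℝ (primitive H t₀)) (hd₁ : Differentiable ℝ (primitive H t₁))
    (hex : ∃ p, IsMaximizer σ (primitive H t₀) x₀ p)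
    (huniq : ∃ p, IsUniqueMaximizer σ (primitive H t₁)
      (x₀ + ∇ (primitive H t₁ - primitive H t₀) p) p) :
    ∃ p, IsUniqueMaximizer σ (primitive H t₀) x₀ p := by
  rcases hA2.convexOn_or_concaveOn_or_proportional hH ht₀ ht₁ h01 with
    hconv | hconc | ⟨c, hc, hprop⟩
  · exact hex.imp fun p hp => hp.isUniqueMaximizer_of_convexOn hσ hσc (hd₀ p) hconv
  · exact huniq.imp fun p hp => hp.of_concaveOn_sub ((hd₁ p).sub (hd₀ p)) hconc
  · exact huniq.imp fun p hp => hp.of_proportional hσ hσc (hd₁ p) hc (hprop p)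

theorem eventually_exists_isSingular
    (hH : ContinuousOn (Function.uncurry H) (Ico 0 T ×ˢ univ))
    (hd : ∀ t ∈ Ico 0 T, Differentiable ℝ (H t))
    (hH' : ContinuousOn (fun z : ℝ × EuclideanSpace ℝ (Fin n) => fderiv ℝ (H z.1) z.2)
      (Ico 0 T ×ˢ univ))
    (hσ : Differentiable ℝ σ) (hσc : ConvexOn ℝ univ σ) (hA1 : Compatible T H σ)
    (hA2 : Structural T H) (hsing : IsSingular T (hopf H σ) t₀ x₀) {ε : ℝ} (hε : 0 < ε) :
    ∀ᶠ t in 𝓝[>] t₀, ∃ x ∈ closedBall x₀ ε, IsSingular T (hopf H σ) t x := by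
  have ht₀ := Ioo_subset_Ico_self hsing.1
  have hdom : (conjDom σ).Nonempty := ⟨∇ σ 0, (isSubgradientOn_univ_iff.1
    (isSubgradientOn_of_hasGradientAt hσc (mem_univ 0) (hσ 0).hasGradientAt)).1⟩
  obtain ⟨N, hN, hmax⟩ := hA1.eventually_exists_isMaximizer hH hdom hsing.1 x₀
  obtain ⟨V, hV, U, hU, hVU⟩ := mem_nhds_prod_iff.1 hmax
  obtain ⟨ρ, hρ, hρU⟩ := Metric.mem_nhds_iff.1 (inter_mem hU (closedBall_mem_nhds x₀ hε))
  filter_upwards [Ioo_mem_nhdsGT hsing.1.2, mem_nhdsWithin_of_mem_nhds hV,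
    eventually_norm_gradient_primitive_sub_lt hH hd hH' ht₀ (isCompact_closedBall 0 N) hρ]
    with t₁ ht htV hgrad
  have ht₁ : t₁ ∈ Ioo 0 T := ⟨hsing.1.1.trans ht.1, ht.2⟩
  have hd₀ := differentiable_primitive hH hd hH' ht₀
  have hd₁ := differentiable_primitive hH hd hH' (Ioo_subset_Ico_self ht₁)
  by_contra! hreg
  have hnear : ∀ p ∈ closedBall 0 N, x₀ + ∇ (primitive H t₁ - primitive H t₀) p ∈
      U ∩ closedBall x₀ ε := fun p hp => hρU (by simpa using hgrad p hp)
  have hmaxU : ∀ x ∈ U, ∃ q ∈ closedBall 0 N, IsMaximizer σ (primitive H t₁) x q := by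
    intro x hx
    simpa only [mem_ofPred_eq] using hVU (mk_mem_prod htV hx)
  have hdiff : ∀ p ∈ closedBall 0 N, DifferentiableAt ℝ (hopf H σ t₁)
      (x₀ + ∇ (primitive H t₁ - primitive H t₀) p) := fun p hp =>
    differentiableAt_of_not_isSingular ht₁ (hreg _ (hnear p hp).2)
  have huniq := exists_isUniqueMaximizer_add_gradient (isCompact_closedBall 0 N)
    (convex_closedBall 0 N) (nonempty_closedBall.2 hN.le) (fun p _ => (hd₁ p).sub (hd₀ p)) hdiff
    (hA1.exists_isMaximizer hH hdom ht₁) (fun p hp => hmaxU _ (hnear p hp).1)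
  obtain ⟨p, hp⟩ := hA2.exists_isUniqueMaximizer hH hσ hσc ht₀ (Ioo_subset_Ico_self ht₁) ht.1.le
    hd₀ hd₁ (hA1.exists_isMaximizer hH hdom hsing.1 x₀) (huniq.imp fun p hp => hp.2)
  exact hsing.2 (hp.hasFDerivAt_hopf hH hsing.1 hmax).differentiableAt

end Propagation

section TimeSlices

variable {E : Type*} [NormedAddCommGroup E] [NormedSpace ℝ E] {f : ℝ × E → ℝ} {I : Set ℝ} {t : ℝ}

theorem hasFDerivAt_prodMk_of_contDiffOn (hf : ContDiffOn ℝ 1 f (I ×ˢ univ)) (ht : t ∈ I)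
    (q : E) : HasFDerivAt (fun q => f (t, q))
      ((fderivWithin ℝ f (I ×ˢ univ) (t, q)).comp (ContinuousLinearMap.inr ℝ ℝ E)) q :=
  (hf.differentiableOn one_ne_zero (t, q) ⟨ht, trivial⟩).hasFDerivWithinAt.comp_hasFDerivAt q
    (hasFDerivAt_prodMk_right t q) (Eventually.of_forall fun _ => ⟨ht, trivial⟩)

theorem continuousOn_fderiv_prodMk_of_contDiffOn (hf : ContDiffOn ℝ 1 f (I ×ˢ univ))
    (hI : UniqueDiffOn ℝ I) :
    ContinuousOn (fun z : ℝ × E => fderiv ℝ (fun q => f (z.1, q)) z.2) (I ×ˢ univ) :=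
  ((hf.continuousOn_fderivWithin (hI.prod uniqueDiffOn_univ) le_rfl).clm_comp
    continuousOn_const).congr fun z hz => (hasFDerivAt_prodMk_of_contDiffOn hf hz.1 z.2).fderiv

end TimeSlices

end HopfFormula

theorem theorem3p4_general {n : ℕ} {T : ℝ}
    {H : ℝ → EuclideanSpace ℝ (Fin n) → ℝ} {σ : EuclideanSpace ℝ (Fin n) → ℝ}
    (hH : ContinuousOn (Function.uncurry H) (Ico 0 T ×ˢ univ))
    (hd : ∀ t ∈ Ico 0 T, Differentiable ℝ (H t))
    (hH' : ContinuousOn (fun z : ℝ × EuclideanSpace ℝ (Fin n) => fderiv ℝ (H z.1) z.2)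
      (Ico 0 T ×ˢ univ))
    (hσ : Differentiable ℝ σ) (hσc : ConvexOn ℝ univ σ)
    (hA1 : HopfFormula.Compatible T H σ) (hA2 : HopfFormula.Structural T H)
    {t₀ : ℝ} {x₀ : EuclideanSpace ℝ (Fin n)}
    (hsing : HopfFormula.IsSingular T (HopfFormula.hopf H σ) t₀ x₀) :
    ∀ ε > 0, ∃ δ > 0, ∀ t' : ℝ, t₀ < t' → |t' - t₀| ≤ δ →
      ∃ x' ∈ closedBall x₀ ε, HopfFormula.IsSingular T (HopfFormula.hopf H σ) t' x' := by
  intro ε hε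
  obtain ⟨s, hs, hsub⟩ := mem_nhdsGT_iff_exists_Ioc_subset.1
    (HopfFormula.eventually_exists_isSingular hH hd hH' hσ hσc hA1 hA2 hsing hε)
  exact ⟨s - t₀, sub_pos.2 hs, fun t' ht' hδ =>
    hsub ⟨ht', sub_le_sub_iff_right t₀ |>.1 ((le_abs_self _).trans hδ)⟩⟩

theorem theorem3p4 {n : ℕ} (T : ℝ) (hT : 0 < T)
    (H : ℝ → EuclideanSpace ℝ (Fin n) → ℝ) (σ : EuclideanSpace ℝ (Fin n) → ℝ)
    (hH : ContDiffOn ℝ 1 (fun z : ℝ × EuclideanSpace ℝ (Fin n) => H z.1 z.2)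
      (Set.Icc 0 T ×ˢ Set.univ))
    (hσ : ContDiff ℝ 1 σ) (hσc : ConvexOn ℝ Set.univ σ)
    (hA1 : HopfFormula.Compatible T H σ) (hA2 : HopfFormula.Structural T H)
    (t₀ : ℝ) (x₀ : EuclideanSpace ℝ (Fin n))
    (hsing : HopfFormula.IsSingular T (HopfFormula.hopf H σ) t₀ x₀) :
    ∀ ε > 0, ∃ δ > 0, ∀ t' : ℝ, t₀ < t' → |t' - t₀| ≤ δ →
      ∃ x' ∈ Metric.closedBall x₀ ε,
        HopfFormula.IsSingular T (HopfFormula.hopf H σ) t' x' :=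
  have hsub := prod_mono_left Ico_subset_Icc_self
  theorem3p4_general (hH.continuousOn.mono hsub)
    (fun _ ht q => (HopfFormula.hasFDerivAt_prodMk_of_contDiffOn hH (Ico_subset_Icc_self ht)
      q).differentiableAt)
    ((HopfFormula.continuousOn_fderiv_prodMk_of_contDiffOn hH (uniqueDiffOn_Icc hT)).mono hsub)
    (hσ.differentiable one_ne_zero) hσc hA1 hA2 hsing
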